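/- Let $G=(V,L)$ be a finite connected simple undirected graph (a network) with a set $M\subseteq V$ of monitors. Each link $l$ carries an unknown real metric $w(l)$. The measurement paths are the simple paths of $G$ joining two distinct monitors, and measuring such a path returns the sum of the metrics of its links. A link $l$ is *identifiable* with monitor set $M$ if $w(l)$ is uniquely determined by the measurements of all measurement paths, i.e. any two metric assignments $w,w':L\to\mathbb{R}$ that give the same sum on every measurement path satisfy $w(l)=w'(l)$. A *biconnected component* $\mathcal{B}$ of $G$ is a maximal connected subgraph that remains connected after deleting any one of its nodes (a single link is allowed). A node $v$ of $\mathcal{B}$ is an *agent* of $\mathcal{B}$ if $v$ is a monitor, or $v$ is a cut-vertex separating $\mathcal{B}$ from at least one monitor $m\notin V(\mathcal{B})$ (every path from $m$ to a node of $\mathcal{B}$ passes through $v$). **Lemma.** Let $\mathcal{B}$ be a biconnected component of $G$ with set of agents $A=\{m'_1,\ldots,m'_\kappa\}$. Let $l$ be a link of $\mathcal{B}$ and, if $\kappa=2$, assume that $l$ is not the direct link $m'_1m'_2$. Then the identifiability of $l$ does not depend on whether the agents are monitors: 1. for every $S\subseteq A$, $l$ is identifiable in $G$ with monitor set $M\cup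 S$ if and only if it is identifiable in $G$ with monitor set $M$; 2. $l$ is identifiable in $G$ with monitor set $M$ if and only if it is identifiable in the graph $\mathcal{B}$ alone with monitor set $A$. The exception is genuine: there are a network $G$, a monitor set $M$ and a biconnected component $\mathcal{B}$ with at least three nodes, exactly two agents $m'_1\neq m'_2$ and a link $m'_1m'_2$, such that $m'_1m'_2$ is identifiable in $G$ with monitor set $M\cup\{m'_1,m'_2\}$ but not with monitor set $M$. -/

import Mathlib

namespace Tomography

variable {V : Type*}

/-- The metric of a walk: link metrics are additive along it. -/
def pathMetric {G : SimpleGraph V} (w : Sym2 V → ℝ) {u v : V} (p : G.Walk u v) : ℝ :=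
  (p.edges.map w).sum

/-- A link `l` of the network `G` is identifiable with monitor set `M` if its metric is uniquely
determined by the metrics of all measurement paths, i.e. of all simple paths of `G` whose
end-points are two distinct monitors. -/
def Identifiable (G : SimpleGraph V) (M : Set V) (l : Sym2 V) : Prop :=
  ∀ w w' : Sym2 V → ℝ,
    (∀ u ∈ M, ∀ v ∈ M, u ≠ v → ∀ p : G.Walk u v, p.IsPath → pathMetric w p = pathMetric w' p) →
    w l = w' l

/-- A connected subgraph that stays connected after the deletion of any one of its nodes
(a single link qualifies). -/
def IsBiconnected {G : SimpleGraph V} (H : G.Subgraph) : Prop :=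
  H.Connected ∧ ∀ v ∈ H.verts, (H.deleteVerts {v}).Preconnected

/-- A biconnected component (block) of `G`: a maximal biconnected subgraph. -/
def IsBiconnectedComponent {G : SimpleGraph V} (B : G.Subgraph) : Prop :=
  Maximal IsBiconnected B

/-- The agents of `B` under the monitor placement `M`: the nodes of `B` that are monitors, and the
nodes of `B` that separate `B` from some monitor `m` outside `B` (every walk from `m` to a node
of `B` visits them; in a connected `G` such a node is a cut-vertex). -/
def agents (G : SimpleGraph V) (M : Set V) (B : G.Subgraph) : Set V :=
  {v | v ∈ B.verts ∧
    (v ∈ M ∨ ∃ m ∈ M, m ∉ B.verts ∧ ∀ b ∈ B.verts, ∀ p : G.Walk m b, v ∈ p.support)}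

end Tomography

/-!
Identifiability of a link `l` says that every metric `z` with sum zero on all measurement paths
vanishes on `l` (`identifiable_iff`). With this, the metrics that are invisible in `G` under `M` are
compared with those that are invisible in the block `B` under its agents.

A path between two nodes of a block stays inside the block, because adding it to `B` gives a
biconnected subgraph (`IsBiconnected.sup_toSubgraph`). Hence a measurement path of `G` meets `B` in
a single subpath whose ends are agents, and a metric on `B` that is invisible to the agents stays
invisible in `G` after extension by zero (`Identifiable.of_component`).

Conversely, each agent is a monitor or is joined to one outside `B` by a path that meets `B` only in
that agent, and for distinct agents these paths are disjoint. If `z` is invisible in `G`, every path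
of `B` between agents `a` and `b` therefore has metric `t a + t b` for some constants `t`
(`exists_pathMetric_eq_add`). With three agents or more, every agent `c` is an inner node of a path
of `B` between two others (`exists_isPath_through`), and cutting this path at `c` gives `t c = 0`;
so `z` is invisible in `B` too. With two agents `a`, `b`, only the sum `t a + t b` is defined by the
paths; subtracting it from the links at `a` makes `z` invisible, which does not affect `z l`, since
an identifiable link other than `ab` meets neither agent (`eq_zero_of_pair`). With at most one
agent, `B` has no measurement paths and there is nothing to show.

Turning agents into monitors does not change the set of agents, so both placements are equivalent
to the same placement on `B`. The exception occurs in a triangle with a pendant monitor at one of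
two agents, the other agent being a monitor itself: the unknown metric of the pendant link hides
that of the link between the agents.
-/

namespace Tomography

open SimpleGraph

variable {V : Type*}

/-! ### Walks and paths -/

theorem isPath_append {G : SimpleGraph V} {u v w : V} {p : G.Walk u v} {q : G.Walk v w}
    (hp : p.IsPath) (hq : q.IsPath) (h : ∀ x ∈ p.support, x ∈ q.support → x = v) :
    (p.append q).IsPath := by
  induction p with
  | nil => simpa using hq
  | @cons a b c e p ih =>
    rw [Walk.cons_isPath_iff] at hp
    rw [Walk.cons_append, Walk.cons_isPath_iff]
    refine ⟨ih hp.1 hq fun x hx hxq => h x (by simp [hx]) hxq, fun ha => ?_⟩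
    rcases (Walk.mem_support_append_iff _ _).1 ha with ha | ha
    · exact hp.2 ha
    · exact hp.2 (h a (by simp) ha ▸ p.end_mem_support)

/-- A walk that meets `s` splits at the first node it has in `s`. -/
theorem exists_append_first_mem {G : SimpleGraph V} (s : Set V) {u v x : V} (p : G.Walk u v)
    (hx : x ∈ p.support) (hxs : x ∈ s) :
    ∃ f ∈ s, ∃ (p₁ : G.Walk u f) (p₂ : G.Walk f v), p = p₁.append p₂ ∧
      ∀ y ∈ p₁.support, y ∈ s → y = f := by
  induction p with
  | nil =>
    obtain rfl : x = _ := by simpa using hx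
    exact ⟨x, hxs, .nil, .nil, rfl, by simp⟩
  | @cons a b c e p ih =>
    by_cases ha : a ∈ s
    · exact ⟨a, ha, .nil, .cons e p, rfl, by simp⟩
    · have hx' : x ∈ p.support := by
        rcases List.mem_cons.1 (by simpa using hx : x ∈ a :: p.support) with rfl | h
        · exact absurd hxs ha
        · exact h
      obtain ⟨f, hf, p₁, p₂, rfl, h⟩ := ih hx'
      refine ⟨f, hf, .cons e p₁, p₂, rfl, fun y hy hys => ?_⟩
      rcases List.mem_cons.1 (by simpa using hy : y ∈ a :: p₁.support) with rfl | hy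
      · exact absurd hys ha
      · exact h y hy hys

/-- If `c` can be reached from `b` without passing through `a`, and no third node separates `a`
from `c`, then some path from `a` to `b` runs through `c`. The path is built by induction along the
walk from `c` to `b`: when the next node `y` already lies on the current path, before `c`, the
part of that path from `y` on forms a cycle with the new link, and a path from `a` that avoids `y`
enters this cycle at a node from which one of the two arcs leads to `y` through `c`. -/
theorem exists_isPath_through {H : SimpleGraph V} {a b c : V}
    (hr : H.Reachable a c) (hac : ∀ y, y ≠ a → y ≠ c → ∃ p : H.Walk a c, y ∉ p.support)
    (p : H.Walk b c) (hp : a ∉ p.support) :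
    ∃ q : H.Walk a b, q.IsPath ∧ c ∈ q.support := by
  classical
  induction p with
  | @nil c =>
    obtain ⟨r⟩ := hr
    exact ⟨r.bypass, r.bypass_isPath, Walk.end_mem_support _⟩
  | @cons y x c e p ih =>
    have hy : y ≠ a := by rintro rfl; simp at hp
    obtain ⟨q, hq, hc⟩ := ih hr hac (fun h => hp (by simp [h]))
    by_cases hyq : y ∈ q.support
    swap
    · refine ⟨q.append (.cons e.symm .nil), isPath_append hq ?_ ?_, ?_⟩
      · simp [Walk.cons_isPath_iff, e.ne']
      · intro z hz hz'
        rcases (by simpa using hz' : z = x ∨ z = y) with rfl | rfl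
        · rfl
        · exact absurd hz hyq
      · exact (Walk.mem_support_append_iff _ _).2 (.inl hc)
    obtain ⟨q₁, d, rfl⟩ := (Walk.mem_support_iff_exists_append).1 hyq
    by_cases hc₁ : c ∈ q₁.support
    · exact ⟨q₁, hq.of_append_left, hc₁⟩
    have hcd : c ∈ d.support := ((Walk.mem_support_append_iff _ _).1 hc).resolve_left hc₁
    obtain ⟨r, hr⟩ := hac y hy (by rintro rfl; exact hc₁ q₁.end_mem_support)
    obtain ⟨h, hh, r₁, r₂, hr₁₂, hfirst⟩ :=
      exists_append_first_mem {z | z ∈ d.support} r.bypass r.bypass.end_mem_support hcd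
    have hr₁ : r₁.IsPath := Walk.IsPath.of_append_left (hr₁₂ ▸ r.bypass_isPath)
    have hyr₁ : y ∉ r₁.support := fun hy' =>
      hr (r.support_bypass_subset_support
        (hr₁₂ ▸ (Walk.mem_support_append_iff _ _).2 (.inl hy')))
    have hd : d.IsPath := hq.of_append_right
    obtain ⟨d₁, d₂, rfl⟩ := (Walk.mem_support_iff_exists_append).1 hh
    by_cases hcd₁ : c ∈ d₁.support
    · refine ⟨r₁.append d₁.reverse, isPath_append hr₁ hd.of_append_left.reverse ?_, ?_⟩
      · intro z hz hz'
        exact hfirst z hz ((Walk.mem_support_append_iff _ _).2 (.inl (by simpa using hz')))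
      · exact (Walk.mem_support_append_iff _ _).2 (.inr (by simpa using hcd₁))
    · have hcd₂ : c ∈ d₂.support := ((Walk.mem_support_append_iff _ _).1 hcd).resolve_left hcd₁
      have hyd₂ : y ∉ d₂.support := fun hy' =>
        hd.ne_of_mem_support_of_append (fun h' => hyr₁ (by rw [h']; exact r₁.end_mem_support))
          d₁.start_mem_support hy' rfl
      have hpath : (r₁.append d₂).IsPath := isPath_append hr₁ hd.of_append_right fun z hz hz' =>
        hfirst z hz ((Walk.mem_support_append_iff _ _).2 (.inr hz'))
      have hy' : y ∉ (r₁.append d₂).support := fun h' =>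
        ((Walk.mem_support_append_iff _ _).1 h').elim hyr₁ hyd₂
      refine ⟨(r₁.append d₂).append (.cons e.symm .nil), isPath_append hpath ?_ ?_, ?_⟩
      · simp [Walk.cons_isPath_iff, e.ne']
      · intro z hz hz'
        rcases (by simpa using hz' : z = x ∨ z = y) with rfl | rfl
        · rfl
        · exact absurd hz hy'
      · exact (Walk.mem_support_append_iff _ _).2
          (.inl ((Walk.mem_support_append_iff _ _).2 (.inr hcd₂)))

/-! ### Metrics of walks -/

section Metric

variable {G : SimpleGraph V} {u v x : V}

theorem pathMetric_append (w : Sym2 V → ℝ) (p : G.Walk u v) (q : G.Walk v x) :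
    pathMetric w (p.append q) = pathMetric w p + pathMetric w q := by
  simp [pathMetric]

theorem pathMetric_reverse (w : Sym2 V → ℝ) (p : G.Walk u v) :
    pathMetric w p.reverse = pathMetric w p := by
  simp [pathMetric]

theorem pathMetric_cons (w : Sym2 V → ℝ) (h : G.Adj u v) (p : G.Walk v x) :
    pathMetric w (.cons h p) = w s(u, v) + pathMetric w p := by
  simp [pathMetric]

theorem pathMetric_sub (w w' : Sym2 V → ℝ) (p : G.Walk u v) :
    pathMetric (fun e => w e - w' e) p = pathMetric w p - pathMetric w' p := by
  induction p with
  | nil => simp [pathMetric]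
  | cons h p ih => rw [pathMetric_cons, pathMetric_cons, pathMetric_cons, ih]; ring

theorem pathMetric_smul (t : ℝ) (w : Sym2 V → ℝ) (p : G.Walk u v) :
    pathMetric (fun e => t * w e) p = t * pathMetric w p := by
  simp [pathMetric, List.sum_map_mul_left]

theorem pathMetric_congr {w w' : Sym2 V → ℝ} {p : G.Walk u v}
    (h : ∀ e ∈ p.edges, w e = w' e) : pathMetric w p = pathMetric w' p := by
  unfold pathMetric
  rw [List.map_congr_left h]

theorem pathMetric_eq_zero {w : Sym2 V → ℝ} {p : G.Walk u v}
    (h : ∀ e ∈ p.edges, w e = 0) : pathMetric w p = 0 := by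
  rw [pathMetric_congr h]
  simp [pathMetric]

/-- By linearity it is enough to compare metrics with the zero metric. -/
theorem identifiable_iff {M : Set V} {l : Sym2 V} :
    Identifiable G M l ↔ ∀ z : Sym2 V → ℝ,
      (∀ u ∈ M, ∀ v ∈ M, u ≠ v → ∀ p : G.Walk u v, p.IsPath → pathMetric z p = 0) → z l = 0 := by
  constructor
  · intro h z hz
    exact h z (fun _ => 0) fun u hu v hv huv p hp => by
      rw [hz u hu v hv huv p hp, pathMetric_eq_zero fun _ _ => rfl]
  · intro h w w' hw
    refine sub_eq_zero.1 (h (fun e => w e - w' e) fun u hu v hv huv p hp => ?_)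
    rw [pathMetric_sub, hw u hu v hv huv p hp, sub_self]

open Classical in
/-- The metric that counts the links at the node `a`. -/
noncomputable def starMetric (a : V) (e : Sym2 V) : ℝ := if a ∈ e then 1 else 0

/-- A path from `a` to another node uses exactly one link at `a`. -/
theorem pathMetric_starMetric {p : G.Walk u v} (hp : p.IsPath) (huv : u ≠ v) :
    pathMetric (starMetric u) p = 1 := by
  cases p with
  | nil => exact absurd rfl huv
  | cons h q =>
    rw [Walk.cons_isPath_iff] at hp
    rw [pathMetric_cons, pathMetric_eq_zero]
    · simp [starMetric]
    · intro e he
      refine if_neg fun hu => hp.2 ?_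
      exact Walk.mem_support_of_mem_edges he hu

end Metric
/-! ### Biconnected components -/

section Block

variable {G : SimpleGraph V} {B : G.Subgraph}

theorem IsBiconnected.exists_walk_avoiding (hB : IsBiconnected B) {x a b : V}
    (ha : a ∈ B.verts) (hb : b ∈ B.verts) (hxa : x ≠ a) (hxb : x ≠ b) :
    ∃ p : G.Walk a b, p.toSubgraph ≤ B ∧ x ∉ p.support := by
  by_cases hx : x ∈ B.verts
  · obtain ⟨p, hp⟩ := (Subgraph.preconnected_iff_forall_exists_walk_subgraph _).1 (hB.2 x hx)
      (u := a) (v := b) ⟨ha, hxa.symm⟩ ⟨hb, hxb.symm⟩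
    refine ⟨p, hp.trans Subgraph.deleteVerts_le, fun h => ?_⟩
    exact (hp.1 ((Walk.mem_verts_toSubgraph p).2 h)).2 rfl
  · obtain ⟨p, hp⟩ := ((Subgraph.connected_iff_forall_exists_walk_subgraph _).1 hB.1).2 ha hb
    exact ⟨p, hp, fun h => hx (hp.1 ((Walk.mem_verts_toSubgraph p).2 h))⟩

theorem toSubgraph_le_deleteVerts {H : G.Subgraph} {u v x : V} {p : G.Walk u v}
    (hp : p.toSubgraph ≤ H) (hx : x ∉ p.support) : p.toSubgraph ≤ H.deleteVerts {x} := by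
  refine ⟨fun y hy => ⟨hp.1 hy, ?_⟩, fun y z hyz => ?_⟩
  · rintro rfl
    exact hx ((Walk.mem_verts_toSubgraph p).1 hy)
  · rw [Subgraph.deleteVerts_adj]
    refine ⟨hp.1 hyz.fst_mem, ?_, hp.1 hyz.snd_mem, ?_, hp.2 hyz⟩
    · rintro rfl
      exact hx ((Walk.mem_verts_toSubgraph p).1 hyz.fst_mem)
    · rintro rfl
      exact hx ((Walk.mem_verts_toSubgraph p).1 hyz.snd_mem)

/-- A path between two nodes of a biconnected subgraph can be added to it: deleting a node of the
path leaves each of its other nodes joined to one of the two ends. -/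
theorem IsBiconnected.sup_toSubgraph (hB : IsBiconnected B) {u v : V} (hu : u ∈ B.verts)
    (hv : v ∈ B.verts) {p : G.Walk u v} (hp : p.IsPath) :
    IsBiconnected (B ⊔ p.toSubgraph) := by
  refine ⟨Subgraph.connected_sup hB.1.preconnected p.toSubgraph_connected.preconnected
    ⟨u, hu, p.start_mem_verts_toSubgraph⟩, fun x hx => ?_⟩
  -- After the deletion of `x`, every remaining node still reaches a node of `B`.
  have key : ∀ y ∈ (B ⊔ p.toSubgraph).verts, y ≠ x → ∃ b ∈ B.verts, b ≠ x ∧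
      ∃ q : G.Walk y b, q.toSubgraph ≤ (B ⊔ p.toSubgraph).deleteVerts {x} := by
    intro y hy hyx
    have hnil : y ∈ B.verts → ∃ b ∈ B.verts, b ≠ x ∧
        ∃ q : G.Walk y b, q.toSubgraph ≤ (B ⊔ p.toSubgraph).deleteVerts {x} := fun h =>
      ⟨y, h, hyx, .nil, toSubgraph_le_deleteVerts
        (by simpa using Or.inl h) (by simpa using hyx.symm)⟩
    rcases hy with hy | hy
    · exact hnil hy
    · rw [Walk.mem_verts_toSubgraph] at hy
      obtain ⟨q, r, rfl⟩ := Walk.mem_support_iff_exists_append.1 hy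
      rw [Walk.toSubgraph_append]
      by_cases hxq : x ∈ q.support
      · have hxr : x ∉ r.support := fun h =>
          hp.ne_of_mem_support_of_append hyx.symm hxq h rfl
        exact ⟨v, hv, fun h => hxr (h ▸ r.end_mem_support), r,
          toSubgraph_le_deleteVerts (le_sup_of_le_right le_sup_right) hxr⟩
      · refine ⟨u, hu, fun h => hxq (h ▸ q.start_mem_support), q.reverse,
          toSubgraph_le_deleteVerts ?_ (by simpa using hxq)⟩
        rw [Walk.toSubgraph_reverse]
        exact le_sup_of_le_right le_sup_left
  rw [Subgraph.preconnected_iff_forall_exists_walk_subgraph]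
  rintro y z ⟨hy, hyx⟩ ⟨hz, hzx⟩
  obtain ⟨b, hb, hbx, q, hq⟩ := key y hy hyx
  obtain ⟨c, hc, hcx, r, hr⟩ := key z hz hzx
  obtain ⟨s, hs, hxs⟩ := hB.exists_walk_avoiding hb hc hbx.symm hcx.symm
  refine ⟨(q.append s).append r.reverse, ?_⟩
  rw [Walk.toSubgraph_append, Walk.toSubgraph_append, Walk.toSubgraph_reverse]
  exact sup_le (sup_le hq (toSubgraph_le_deleteVerts (hs.trans le_sup_left) hxs)) hr

theorem IsBiconnectedComponent.toSubgraph_le (hB : IsBiconnectedComponent B) {u v : V}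
    (hu : u ∈ B.verts) (hv : v ∈ B.verts) {p : G.Walk u v} (hp : p.IsPath) :
    p.toSubgraph ≤ B :=
  le_sup_right.trans (hB.2 (hB.1.sup_toSubgraph hu hv hp) le_sup_left)

/-- A walk inside `B`, regarded as a walk of the network `B.spanningCoe`. -/
theorem exists_walk_spanningCoe {u v : V} {p : G.Walk u v} (hp : p.toSubgraph ≤ B) :
    ∃ q : B.spanningCoe.Walk u v, q.support = p.support ∧ q.edges = p.edges ∧
      (p.IsPath → q.IsPath) := by
  have h : ∀ e ∈ p.edges, e ∈ B.spanningCoe.edgeSet := fun e he => by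
    rw [Subgraph.edgeSet_spanningCoe]
    exact Subgraph.edgeSet_mono hp ((Walk.mem_edges_toSubgraph p).2 he)
  exact ⟨p.transfer _ h, p.support_transfer h, p.edges_transfer h, fun hp => hp.transfer h⟩

/-- If `f` is the only node of `B` on a path from `f` to a node `m` outside `B`, then every walk
from `m` to `B` visits `f`: otherwise some path would leave `B` at `f` and return elsewhere. -/
theorem IsBiconnectedComponent.mem_support_of_first (hB : IsBiconnectedComponent B) {f m b : V}
    (hf : f ∈ B.verts) (hm : m ∉ B.verts) {p : G.Walk f m} (hp : p.IsPath)
    (hfirst : ∀ y ∈ p.support, y ∈ B.verts → y = f) (hb : b ∈ B.verts) (r : G.Walk m b) :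
    f ∈ r.support := by
  classical
  cases p with
  | nil => exact absurd hf hm
  | @cons _ y _ e t =>
    rw [Walk.cons_isPath_iff] at hp
    by_contra hr
    have hft : f ∉ (t.append r).bypass.support := fun h =>
      ((Walk.mem_support_append_iff _ _).1
        ((t.append r).support_bypass_subset_support h)).elim hp.2 hr
    have hpath : (Walk.cons e (t.append r).bypass).IsPath :=
      (Walk.cons_isPath_iff _ _).2 ⟨(t.append r).bypass_isPath, hft⟩
    have hy : y ∈ B.verts := (hB.toSubgraph_le hf hb hpath).1
      ((Walk.mem_verts_toSubgraph _).2 (by simp))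
    exact hp.2 (hfirst y (by simp) hy ▸ t.start_mem_support)

/-- Every agent `a` is reached from a monitor `m` by a path that meets `B` in `a` only, and all
walks from `m` to `B` visit `a`. -/
theorem exists_isPath_of_mem_agents (hG : G.Connected) {M : Set V} {a : V}
    (ha : a ∈ agents G M B) :
    ∃ m ∈ M, ∃ p : G.Walk m a, p.IsPath ∧ (∀ y ∈ p.support, y ∈ B.verts → y = a) ∧
      ∀ b ∈ B.verts, ∀ q : G.Walk m b, a ∈ q.support := by
  classical
  obtain ⟨haB, ha | ⟨m, hm, -, hsep⟩⟩ := ha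
  · exact ⟨a, ha, .nil, .nil, by simp, fun b _ q => q.start_mem_support⟩
  · obtain ⟨p⟩ := hG.preconnected m a
    obtain ⟨f, hf, p₁, p₂, hp, hfirst⟩ :=
      exists_append_first_mem B.verts p.bypass p.bypass.end_mem_support haB
    obtain rfl : a = f := hfirst a (hsep f hf p₁) haB
    exact ⟨m, hm, p₁, Walk.IsPath.of_append_left (hp ▸ p.bypass_isPath), hfirst, hsep⟩

theorem pathMetric_eq_zero_of_first {z : Sym2 V → ℝ} (hz : ∀ e ∉ B.edgeSet, z e = 0) {f m : V}
    {p : G.Walk m f} (hfirst : ∀ y ∈ p.support, y ∈ B.verts → y = f) : pathMetric z p = 0 := by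
  refine pathMetric_eq_zero fun e he => hz e fun heB => ?_
  induction e with
  | _ x y =>
    have hxy : B.Adj x y := heB
    have hx := hfirst x (p.fst_mem_support_of_mem_edges he) hxy.fst_mem
    have hy := hfirst y (p.snd_mem_support_of_mem_edges he) hxy.snd_mem
    exact hxy.ne (hx.trans hy.symm)

/-- A measurement path of `G` meets `B` in a path between two agents, so link metrics of `B` that
the agents cannot tell from zero remain so when they are extended to `G` by zero. -/
theorem Identifiable.of_component (hB : IsBiconnectedComponent B) {M : Set V}
    {l : Sym2 V} (hl : l ∈ B.edgeSet) (h : Identifiable G M l) :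
    Identifiable B.spanningCoe (agents G M B) l := by
  classical
  rw [identifiable_iff] at h ⊢
  intro z hz
  let z' : Sym2 V → ℝ := fun e => if e ∈ B.edgeSet then z e else 0
  have hz' : ∀ e ∉ B.edgeSet, z' e = 0 := fun e he => if_neg he
  have hzl : z' l = z l := if_pos hl
  rw [← hzl]
  refine h z' fun m hm n hn _ p hp => ?_
  by_cases hpB : ∃ x ∈ p.support, x ∈ B.verts
  swap
  · refine pathMetric_eq_zero fun e he => hz' e fun heB => hpB ?_
    induction e with
    | _ x y => exact ⟨x, p.fst_mem_support_of_mem_edges he, Subgraph.Adj.fst_mem heB⟩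
  obtain ⟨x, hx, hxB⟩ := hpB
  obtain ⟨f, hf, p₁, p₂, rfl, hf₁⟩ := exists_append_first_mem B.verts p hx hxB
  obtain ⟨g, hg, q₁, q₂, hq, hg₁⟩ :=
    exists_append_first_mem B.verts p₂.reverse p₂.reverse.end_mem_support hf
  obtain rfl : p₂ = q₂.reverse.append q₁.reverse := by
    rw [← Walk.reverse_append, ← hq, Walk.reverse_reverse]
  have hp₂ := hp.of_append_right
  have agent : ∀ {k c : V}, k ∈ M → c ∈ B.verts → ∀ r : G.Walk k c, r.IsPath →
      (∀ y ∈ r.support, y ∈ B.verts → y = c) → c ∈ agents G M B := by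
    intro k c hk hc r hr hfirst
    refine ⟨hc, ?_⟩
    by_cases hkB : k ∈ B.verts
    · exact .inl (hfirst k r.start_mem_support hkB ▸ hk)
    · exact .inr ⟨k, hk, hkB, fun b hb s =>
        hB.mem_support_of_first hc hkB hr.reverse (by simpa using hfirst) hb s⟩
  have hfA := agent hm hf p₁ hp.of_append_left hf₁
  have hgA := agent hn hg q₁ ((Walk.isPath_reverse_iff _).1 hp₂.of_append_right) hg₁
  rw [pathMetric_append, pathMetric_append, pathMetric_reverse, pathMetric_reverse,
    pathMetric_eq_zero_of_first hz' hf₁, pathMetric_eq_zero_of_first hz' hg₁]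
  suffices h₂ : pathMetric z' q₂.reverse = 0 by rw [pathMetric_reverse] at h₂; simp [h₂]
  have hpath : q₂.reverse.IsPath := hp₂.of_append_left
  have hle := hB.toSubgraph_le hf hg hpath
  by_cases hfg : f = g
  · subst hfg
    rw [(Walk.isPath_iff_nil.1 hpath).eq_nil]
    rfl
  · obtain ⟨q, -, hqe, hqp⟩ := exists_walk_spanningCoe hle
    rw [← hz f hfA g hgA hfg q (hqp hpath)]
    unfold pathMetric
    rw [hqe]
    refine congrArg _ (List.map_congr_left fun e he => if_pos ?_)
    exact Subgraph.edgeSet_mono hle ((Walk.mem_edges_toSubgraph _).2 he)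

/-- The monitors behind two agents turn every path of `B` between these agents into a measurement
path, at the price of an additive constant for each agent. -/
theorem exists_pathMetric_eq_add (hG : G.Connected) {M : Set V} {z : Sym2 V → ℝ}
    (hz : ∀ u ∈ M, ∀ v ∈ M, u ≠ v → ∀ p : G.Walk u v, p.IsPath → pathMetric z p = 0) :
    ∃ t : V → ℝ, ∀ a ∈ agents G M B, ∀ b ∈ agents G M B, a ≠ b →
      ∀ p : B.spanningCoe.Walk a b, p.IsPath → pathMetric z p = t a + t b := by
  classical
  choose m hm p hp hfirst hsep using
    fun a (ha : a ∈ agents G M B) => exists_isPath_of_mem_agents hG ha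
  refine ⟨fun a => if ha : a ∈ agents G M B then -pathMetric z (p a ha) else 0,
    fun a ha b hb hab q hq => ?_⟩
  have hdisj : ∀ x ∈ (p a ha).support, x ∉ (p b hb).support := by
    intro x hxa hxb
    obtain ⟨r₁, r₂, hr⟩ := Walk.mem_support_iff_exists_append.1 hxa
    obtain ⟨s₁, s₂, hs⟩ := Walk.mem_support_iff_exists_append.1 hxb
    have hb' : a ∉ (p b hb).support := fun h => hab (hfirst b hb a h ha.1)
    have hmem := hsep a ha b hb.1 (r₁.append s₂)
    rcases (Walk.mem_support_append_iff _ _).1 hmem with h | h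
    · have hax : a ≠ x := by rintro rfl; exact hb' hxb
      have hpa : (r₁.append r₂).IsPath := hr ▸ hp a ha
      exact hpa.ne_of_mem_support_of_append hax h r₂.end_mem_support rfl
    · exact hb' (hs ▸ (Walk.mem_support_append_iff _ _).2 (.inr h))
  have hmab : m a ha ≠ m b hb := fun h => by
    refine hdisj _ (p a ha).start_mem_support ?_
    rw [h]
    exact (p b hb).start_mem_support
  have hqB : ∀ x ∈ q.support, x ∈ B.verts := by
    intro x hx
    have hnil : ¬ q.Nil := Walk.not_nil_of_ne hab
    obtain ⟨e, he, hxe⟩ := (Walk.mem_support_iff_exists_mem_edges_of_not_nil hnil).1 hx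
    have := q.edges_subset_edgeSet he
    rw [Subgraph.edgeSet_spanningCoe] at this
    exact Subgraph.mem_verts_of_mem_edge this hxe
  let q' := q.mapLe B.spanningCoe_le
  have hq' : q'.IsPath := (Walk.isPath_mapLe _).2 hq
  have hq's : q'.support = q.support := by simp [q']
  have hpath₁ : ((p a ha).append q').IsPath := isPath_append (hp a ha) hq' fun x hx hxq =>
    hfirst a ha x hx (hqB x (hq's ▸ hxq))
  have hpath : (((p a ha).append q').append (p b hb).reverse).IsPath :=
    isPath_append hpath₁ (hp b hb).reverse fun x hx hxb => by
      rw [Walk.support_reverse, List.mem_reverse] at hxb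
      rcases (Walk.mem_support_append_iff _ _).1 hx with hx | hx
      · exact absurd hxb (hdisj x hx)
      · exact hfirst b hb x hxb (hqB x (hq's ▸ hx))
  have hsum := hz _ (hm a ha) _ (hm b hb) hmab _ hpath
  rw [pathMetric_append, pathMetric_append, pathMetric_reverse] at hsum
  have hqq : pathMetric z q' = pathMetric z q := by
    unfold pathMetric
    rw [show q'.edges = q.edges by simp [q']]
  rw [hqq] at hsum
  simp only [dif_pos ha, dif_pos hb]
  linarith

/-- If there are at least three agents, the constants vanish: an agent `c` lies on a path of `B`
between two other agents `a` and `b`, and `t a + t b = (t a + t c) + (t c + t b)`. -/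
theorem IsBiconnected.eq_zero_of_three (hB : IsBiconnected B) {A : Set V}
    (hA : A ⊆ B.verts) {z : Sym2 V → ℝ} {t : V → ℝ}
    (ht : ∀ a ∈ A, ∀ b ∈ A, a ≠ b →
      ∀ p : B.spanningCoe.Walk a b, p.IsPath → pathMetric z p = t a + t b)
    {a b c : V} (ha : a ∈ A) (hb : b ∈ A) (hc : c ∈ A) (hab : a ≠ b) (hac : a ≠ c) (hbc : b ≠ c) :
    t c = 0 := by
  have hwalk : ∀ {x y u : V}, x ∈ A → y ∈ A → u ≠ x → u ≠ y →
      ∃ p : B.spanningCoe.Walk x y, u ∉ p.support := by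
    intro x y u hx hy hux huy
    obtain ⟨p, hpB, hp⟩ := hB.exists_walk_avoiding (hA hx) (hA hy) hux huy
    obtain ⟨q, hq, -⟩ := exists_walk_spanningCoe hpB
    exact ⟨q, hq ▸ hp⟩
  obtain ⟨p, hp⟩ := hwalk hb hc hab hac
  obtain ⟨r, -⟩ := hwalk ha hc hab.symm hbc
  obtain ⟨q, hq, hcq⟩ := exists_isPath_through ⟨r⟩ (fun y => hwalk ha hc) p hp
  obtain ⟨q₁, q₂, rfl⟩ := Walk.mem_support_iff_exists_append.1 hcq
  have h := ht a ha b hb hab _ hq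
  rw [pathMetric_append, ht a ha c hc hac _ hq.of_append_left,
    ht c hc b hb hbc.symm _ hq.of_append_right] at h
  linarith

/-- With exactly two monitors `a` and `b`, an identifiable link other than `ab` meets neither, since
the metric counting links at `a` minus links at `b` is invisible. Shifting the metric of the links
at `a` by the constant that all paths between `a` and `b` have in common therefore does not affect
the link. -/
theorem eq_zero_of_pair {H : SimpleGraph V} {a b : V} (hab : a ≠ b) {l : Sym2 V}
    (hl : l ≠ s(a, b)) (h : Identifiable H {a, b} l) {z : Sym2 V → ℝ} {t : ℝ}
    (ht : ∀ p : H.Walk a b, p.IsPath → pathMetric z p = t) : z l = 0 := by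
  have sym : ∀ y : Sym2 V → ℝ, (∀ p : H.Walk a b, p.IsPath → pathMetric y p = 0) → y l = 0 := by
    intro y hy
    refine identifiable_iff.1 h y fun u hu v hv huv p hp => ?_
    rcases hu with rfl | rfl <;> rcases hv with rfl | rfl
    · exact absurd rfl huv
    · exact hy p hp
    · rw [← pathMetric_reverse]
      exact hy _ hp.reverse
    · exact absurd rfl huv
  have h₁ := sym (fun e => starMetric a e - starMetric b e) fun p hp => by
    rw [pathMetric_sub, pathMetric_starMetric hp hab, ← pathMetric_reverse (starMetric b),
      pathMetric_starMetric hp.reverse hab.symm, sub_self]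
  have h₂ := sym (fun e => z e - t * starMetric a e) fun p hp => by
    rw [pathMetric_sub, pathMetric_smul, pathMetric_starMetric hp hab, ht p hp, mul_one, sub_self]
  have ha : a ∉ l := fun ha => by
    have hb : b ∉ l := fun hb => hl ((Sym2.mem_and_mem_iff hab).1 ⟨ha, hb⟩)
    simp [starMetric, ha, hb] at h₁
  simpa [starMetric, ha] using h₂

theorem identifiable_iff_component (hG : G.Connected) (hB : IsBiconnectedComponent B) {M : Set V}
    {l : Sym2 V} (hl : l ∈ B.edgeSet)
    (hne : ¬ ∃ a b : V, a ≠ b ∧ agents G M B = {a, b} ∧ l = s(a, b)) :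
    Identifiable G M l ↔ Identifiable B.spanningCoe (agents G M B) l := by
  refine ⟨Identifiable.of_component hB hl, fun h => identifiable_iff.2 fun z hz => ?_⟩
  obtain ⟨t, ht⟩ := exists_pathMetric_eq_add (B := B) hG hz
  by_cases hsub : (agents G M B).Subsingleton
  · exact identifiable_iff.1 h z fun u hu v hv huv => absurd (hsub hu hv) huv
  obtain ⟨a, ha, b, hb, hab⟩ := Set.not_subsingleton_iff.1 hsub
  by_cases hthree : ∃ c ∈ agents G M B, c ≠ a ∧ c ≠ b
  · obtain ⟨c, hc, hca, hcb⟩ := hthree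
    have hzero : ∀ x ∈ agents G M B, t x = 0 := by
      intro x hx
      have key := fun {u v w : V} =>
        hB.1.eq_zero_of_three (fun _ h => h.1) ht (a := u) (b := v) (c := w)
      by_cases hxa : x = a
      · exact key hb hc hx hcb.symm (hxa ▸ hab.symm) (hxa ▸ hca)
      · by_cases hxb : x = b
        · exact key ha hc hx hca.symm (Ne.symm hxa) (hxb ▸ hcb)
        · exact key ha hb hx hab (Ne.symm hxa) (Ne.symm hxb)
    refine identifiable_iff.1 h z fun u hu v hv huv p hp => ?_
    rw [ht u hu v hv huv p hp, hzero u hu, hzero v hv, add_zero]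
  · have hpair : agents G M B = {a, b} := by
      refine Set.Subset.antisymm (fun c hc => ?_) (by rintro x (rfl | rfl) <;> assumption)
      by_contra hcab
      rw [Set.mem_insert_iff, Set.mem_singleton_iff, not_or] at hcab
      exact hthree ⟨c, hc, hcab.1, hcab.2⟩
    exact eq_zero_of_pair hab (fun hl => hne ⟨a, b, hab, hpair, hl⟩) (hpair ▸ h) (ht a ha b hb hab)

theorem agents_union {M S : Set V} (hS : S ⊆ agents G M B) :
    agents G (M ∪ S) B = agents G M B := by
  ext v
  constructor
  · rintro ⟨hv, (hvM | hvS) | ⟨m, hm | hm, hmB, hsep⟩⟩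
    · exact ⟨hv, .inl hvM⟩
    · exact hS hvS
    · exact ⟨hv, .inr ⟨m, hm, hmB, hsep⟩⟩
    · exact absurd (hS hm).1 hmB
  · rintro ⟨hv, hvM | ⟨m, hm, h⟩⟩
    · exact ⟨hv, .inl (.inl hvM)⟩
    · exact ⟨hv, .inr ⟨m, .inl hm, h⟩⟩

end Block
/-! ### The exceptional link between two agents -/

/-- A triangle on the nodes `0`, `1`, `2` with a pendant link from `0` to `3`. -/
def pawGraph : SimpleGraph (Fin 4) where
  Adj a b := a ≠ b ∧ (a = 3 → b = 0) ∧ (b = 3 → a = 0)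
  symm := ⟨fun _ _ h => ⟨h.1.symm, h.2.2, h.2.1⟩⟩
  loopless := ⟨fun _ h => h.1 rfl⟩

/-- The triangle of `pawGraph`. -/
def pawTriangle : pawGraph.Subgraph := (⊤ : pawGraph.Subgraph).induce {v | v ≠ 3}

theorem pawTriangle_adj {u v : Fin 4} : pawTriangle.Adj u v ↔ u ≠ 3 ∧ v ≠ 3 ∧ u ≠ v := by
  refine ⟨fun h => ⟨h.1, h.2.1, h.2.2.ne⟩, fun h => ⟨h.1, h.2.1, ?_⟩⟩
  exact ⟨h.2.2, fun h' => absurd h' h.1, fun h' => absurd h' h.2.1⟩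

theorem mem_support_of_pawGraph_walk {b : Fin 4} (hb : b ≠ 3) (p : pawGraph.Walk 3 b) :
    0 ∈ p.support := by
  cases p with
  | nil => exact absurd rfl hb
  | cons e q =>
    obtain rfl := e.2.1 rfl
    simp

theorem pawGraph_connected : pawGraph.Connected := by
  have h : ∀ v, pawGraph.Reachable 0 v := fun v => by
    by_cases hv : 0 = v
    · rw [hv]
    · exact Adj.reachable ⟨hv, fun h => absurd h (by decide), fun _ => rfl⟩
  exact ⟨fun u v => (h u).symm.trans (h v)⟩

theorem isBiconnectedComponent_pawTriangle : IsBiconnectedComponent pawTriangle := by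
  refine ⟨⟨Subgraph.connected_iff.2 ⟨⟨?_⟩, ⟨0, ?_⟩⟩, fun x _ => ⟨?_⟩⟩, fun H hH hle => ?_⟩
  · rintro ⟨u, hu⟩ ⟨v, hv⟩
    by_cases huv : u = v
    · subst huv; rfl
    · exact Adj.reachable (pawTriangle_adj.2 ⟨hu, hv, huv⟩)
  · exact (by decide : (0 : Fin 4) ≠ 3)
  · rintro ⟨u, hu, hux⟩ ⟨v, hv, hvx⟩
    by_cases huv : u = v
    · subst huv; rfl
    · exact Adj.reachable
        (Subgraph.deleteVerts_adj.2 ⟨hu, hux, hv, hvx, pawTriangle_adj.2 ⟨hu, hv, huv⟩⟩)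
  · have h₃ : ∀ v ∈ H.verts, v ≠ 3 := by
      rintro v hv rfl
      obtain ⟨p, -, hp⟩ := hH.exists_walk_avoiding (x := 0) (b := 1) hv
        (hle.1 (show (1 : Fin 4) ≠ 3 by decide)) (by decide) (by decide)
      exact hp (mem_support_of_pawGraph_walk (by decide) p)
    exact ⟨h₃, fun u v huv => pawTriangle_adj.2 ⟨h₃ u huv.fst_mem, h₃ v huv.snd_mem, huv.ne⟩⟩

theorem agents_pawTriangle : agents pawGraph {3, 1} pawTriangle = {0, 1} := by
  ext v
  constructor
  · rintro ⟨hv, (rfl | rfl) | ⟨m, rfl | rfl, hm, hsep⟩⟩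
    · exact absurd rfl hv
    · simp
    · -- The single link from `3` to `0` visits no other node of the triangle.
      have h := hsep 0 (show (0 : Fin 4) ≠ 3 by decide)
        (.cons (show pawGraph.Adj 3 0 from ⟨by decide, fun _ => rfl, by decide⟩) .nil)
      rcases (by simpa using h : v = 3 ∨ v = 0) with rfl | rfl
      · exact absurd rfl hv
      · simp
    · exact absurd (show (1 : Fin 4) ≠ 3 by decide) hm
  · rintro (rfl | rfl)
    · exact ⟨show (0 : Fin 4) ≠ 3 by decide, .inr ⟨3, by simp, fun h => h rfl,
        fun b hb p => mem_support_of_pawGraph_walk hb p⟩⟩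
    · exact ⟨show (1 : Fin 4) ≠ 3 by decide, .inl (by simp)⟩

/-- Raising the metric of the pendant link by one and lowering the two other links at `0` by one
changes no path from `3` to `1`. -/
theorem not_identifiable_pawGraph : ¬ Identifiable pawGraph {3, 1} s(0, 1) := by
  classical
  rw [identifiable_iff]
  intro h
  let z : Sym2 (Fin 4) → ℝ := fun e => if 3 ∈ e then 1 else -1 * starMetric 0 e
  have key : ∀ p : pawGraph.Walk 3 1, p.IsPath → pathMetric z p = 0 := by
    intro p hp
    cases p with
    | cons e q =>
      obtain rfl := e.2.1 rfl
      rw [Walk.cons_isPath_iff] at hp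
      have hq : pathMetric z q = pathMetric (fun e => -1 * starMetric 0 e) q :=
        pathMetric_congr fun e he =>
          if_neg fun h₃ => hp.2 (Walk.mem_support_of_mem_edges he h₃)
      rw [pathMetric_cons, hq, pathMetric_smul, pathMetric_starMetric hp.1 (by decide)]
      simp [z]
  have h₀ : z s(0, 1) = 0 := h z fun u hu v hv huv p hp => by
    rcases hu with rfl | rfl <;> rcases hv with rfl | rfl
    · exact absurd rfl huv
    · exact key p hp
    · rw [← pathMetric_reverse]
      exact key _ hp.reverse
    · exact absurd rfl huv
  simp [z, starMetric] at h₀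

theorem identifiable_of_adj {G : SimpleGraph V} {M : Set V} {a b : V} (h : G.Adj a b)
    (ha : a ∈ M) (hb : b ∈ M) : Identifiable G M s(a, b) := by
  intro w w' hw
  simpa [pathMetric] using hw a ha b hb h.ne (.cons h .nil)
    (by simp [Walk.cons_isPath_iff, h.ne])

end Tomography

/-- In the first part, `B.spanningCoe` is `B` regarded as a network of its own (the nodes outside
`B` are isolated and carry no monitor). The second part says that the exception is genuine. -/
theorem mainTheorem5 :
    (∀ (V : Type*) [Finite V] (G : SimpleGraph V), G.Connected →
      ∀ (M : Set V) (B : G.Subgraph), Tomography.IsBiconnectedComponent B →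
      ∀ l ∈ B.edgeSet,
        (¬ ∃ a b : V, a ≠ b ∧ Tomography.agents G M B = {a, b} ∧ l = s(a, b)) →
        (∀ S ⊆ Tomography.agents G M B,
          (Tomography.Identifiable G (M ∪ S) l ↔ Tomography.Identifiable G M l)) ∧
        (Tomography.Identifiable G M l ↔
          Tomography.Identifiable B.spanningCoe (Tomography.agents G M B) l)) ∧
    (∃ (V : Type) (_ : Finite V) (G : SimpleGraph V) (M : Set V) (B : G.Subgraph) (a b : V),
      G.Connected ∧ Tomography.IsBiconnectedComponent B ∧ 3 ≤ B.verts.ncard ∧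
      a ≠ b ∧ Tomography.agents G M B = {a, b} ∧ B.Adj a b ∧
      Tomography.Identifiable G (M ∪ {a, b}) s(a, b) ∧
      ¬ Tomography.Identifiable G M s(a, b)) := by
  refine ⟨?_, Fin 4, inferInstance, Tomography.pawGraph, {3, 1}, Tomography.pawTriangle, 0, 1,
    Tomography.pawGraph_connected, Tomography.isBiconnectedComponent_pawTriangle, ?_, by decide,
    Tomography.agents_pawTriangle, Tomography.pawTriangle_adj.2 (by decide), ?_,
    Tomography.not_identifiable_pawGraph⟩
  · intro V _ G hG M B hB l hl hne
    have key := Tomography.identifiable_iff_component hG hB hl hne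
    refine ⟨fun S hS => ?_, key⟩
    have hA := Tomography.agents_union hS
    rw [key, Tomography.identifiable_iff_component hG hB (M := M ∪ S) hl (by rwa [hA]), hA]
  · rw [show Tomography.pawTriangle.verts = {3}ᶜ from rfl, Set.ncard_compl]
    simp
  · exact Tomography.identifiable_of_adj
      (Tomography.pawTriangle_adj.2 (by decide) : Tomography.pawTriangle.Adj 0 1).adj_sub
      (by simp) (by simp)
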